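/- Let $d\ge 1$, $\mathcal H_A=\mathcal H_B=\mathbb C^d$. For $\vec a=(a_1,a_2,a_3)\in\{0,\dots,d-1\}^3$ let $wt(\vec a)\in\{1,2,3\}$ be the largest number of equal entries of $\vec a$, and let $$O_+=\sum_{\vec a}\bigl[1+(-d)^{wt(\vec a)-1}\bigr]\,|\vec a\rangle\langle\vec a|$$ on $(\mathbb C^d)^{\otimes 3}$. For a probability measure $\mathcal E$ on the unitary group $U(d)$ put $\Phi^3_{\mathcal E}(X)=\int U^{\otimes 3}X\,U^{\dagger\otimes 3}\,d\mathcal E(U)$; $\mathcal E$ is a unitary $3$-design if $\Phi^3_{\mathcal E}(X)=\Phi^3_{\mathrm{Haar}}(X)$ for every operator $X$ on $(\mathbb C^d)^{\otimes 3}$. Let $\mathcal E_A,\mathcal E_B$ be unitary $3$-designs on $U(d)$, and write $\Phi^3_A=\Phi^3_{\mathcal E_A}$, $\Phi^3_B=\Phi^3_{\mathcal E_B}$. Then for every density matrix $\rho=\rho_{AB}$ on $\mathcal H_A\otimes\mathcal H_B$, with reduced states $\rho_A=\mathrm{Tr}_B\,\rho_{AB}$, $\rho_B=\mathrm{Tr}_A\,\rho_{AB}$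 and partial transpose $\rho_{AB}^{T_A}$, $$ \begin{aligned} \mathrm{Tr}\bigl[(\Phi^3_A(O_+^2)\otimes\Phi^3_B(O_+^2))\,\rho_{AB}^{\otimes 3}\bigr] =\frac{1}{(d+2)^2}\Big\{&[\mathrm{Tr}(\rho_A^2)+\mathrm{Tr}(\rho_B^2)]\;3d(d-1)^2(d+1)(d^2+3d+4)\\ &+[\mathrm{Tr}(\rho_A^3)+\mathrm{Tr}(\rho_B^3)]\;2(d-1)\bigl(6+(d-1)d^2\bigr)(d^2+3d+4)\\ &+\mathrm{Tr}(\rho_{AB}^2)\;3d^2(d^2-1)^2+\mathrm{Tr}(\rho_{AB}^3)\;2\bigl(6+(d-1)d^2\bigr)^2\\ &+\mathrm{Tr}[\rho_{AB}(\rho_A\otimes\rho_B)]\;6d^2(d^2-1)^2\\ &+\bigl(\mathrm{Tr}[\rho_{AB}^2(\rho_A\otimes I)]+\mathrm{Tr}[\rho_{AB}^2(I\otimes\rho_B)]\bigr)\;6d(d-1)(d+1)\bigl((d-1)d^2+6\bigr)\\ &+2\,\mathrm{Tr}[(\rho_{AB}^{T_A})^3]\,\bigl((d-1)d^2+6\bigr)^2+\bigl(d(d+1)^2-4\bigr)^2\Big\},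 \end{aligned} $$ where the three $A$-factors and the three $B$-factors of $(\mathcal H_A\otimes\mathcal H_B)^{\otimes 3}$ are those on which $\Phi^3_A(O_+^2)$ and $\Phi^3_B(O_+^2)$ act, respectively. -/

import Mathlib

open MeasureTheory Matrix
open scoped Kronecker ComplexOrder

noncomputable section

namespace BilocalTwirl

/-- The unitary group `U(d)`, with the topology inherited from the space of matrices. -/
abbrev U (d : ℕ) : Type := Matrix.unitaryGroup (Fin d) ℂ

/-- The unitary group carries its Borel sigma-algebra. -/
instance instMeasurableSpaceU (d : ℕ) : MeasurableSpace (U d) := borel (U d)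

instance instBorelSpaceU (d : ℕ) : BorelSpace (U d) := ⟨rfl⟩

instance instCompactSpaceU (d : ℕ) : CompactSpace (U d) := by
  have hK : @IsCompact (Matrix (Fin d) (Fin d) ℂ) _
      (Set.univ.pi fun _ => Set.univ.pi fun _ => Metric.closedBall (0 : ℂ) 1) :=
    isCompact_univ_pi (X := fun _ : Fin d => Fin d → ℂ)
      fun _ => isCompact_univ_pi fun _ => isCompact_closedBall (0 : ℂ) 1
  have hU : IsCompact (Matrix.unitaryGroup (Fin d) ℂ : Set (Matrix (Fin d) (Fin d) ℂ)) := by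
    refine hK.of_isClosed_subset isClosed_unitary ?_
    intro A hA i _ j _
    simpa using entry_norm_bound_of_unitary hA i j
  exact isCompact_iff_compactSpace.mp hU

/-- The Haar measure on the compact group `U(d)`, normalised to total mass one. -/
def haarU (d : ℕ) : Measure (U d) := Measure.haarMeasure ⊤

/-- The tensor power `M^{⊗k}`, acting on `(ℂ^n)^{⊗k}` with basis the strings `Fin k → n`. -/
def tensorPow {n : Type*} (k : ℕ) (M : Matrix n n ℂ) : Matrix (Fin k → n) (Fin k → n) ℂ :=
  Matrix.of fun a b => ∏ i, M (a i) (b i)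

/-- The `k`-fold twirl `X ↦ ∫ V^{⊗k} X (V†)^{⊗k} dμ(V)` of an ensemble `μ` of unitaries.
The matrix-valued integral is taken entry by entry; each entry is a continuous function on a
compact group. -/
def twirl {d : ℕ} (k : ℕ) (μ : Measure (U d))
    (X : Matrix (Fin k → Fin d) (Fin k → Fin d) ℂ) :
    Matrix (Fin k → Fin d) (Fin k → Fin d) ℂ :=
  Matrix.of fun a b => ∫ V : U d,
    (tensorPow k (V : Matrix (Fin d) (Fin d) ℂ) * X *
      tensorPow k (V : Matrix (Fin d) (Fin d) ℂ)ᴴ) a b ∂μ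

/-- A (probability) ensemble `μ` is a unitary `k`-design if its `k`-fold twirl is that of the
Haar measure. -/
def IsUnitaryDesign {d : ℕ} (k : ℕ) (μ : Measure (U d)) : Prop :=
  IsProbabilityMeasure μ ∧
    ∀ X : Matrix (Fin k → Fin d) (Fin k → Fin d) ℂ, twirl k μ X = twirl k (haarU d) X

/-- The weight of a string: the largest number of positions holding the same letter. -/
def wt {d : ℕ} (a : Fin 3 → Fin d) : ℕ :=
  Finset.univ.sup fun i => (Finset.univ.filter fun j => a j = a i).card

/-- The diagonal observable `O₊ = ∑ₐ (1 + (-d)^{wt(a)-1}) |a⟩⟨a|`. The weight is at least one. -/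
def OPlus (d : ℕ) : Matrix (Fin 3 → Fin d) (Fin 3 → Fin d) ℂ :=
  Matrix.diagonal fun a => 1 + (-(d : ℂ)) ^ (wt a - 1)

/-- Density matrices: positive semidefinite with trace one. -/
def IsState {n : Type*} [Fintype n] (ρ : Matrix n n ℂ) : Prop :=
  ρ.PosSemidef ∧ ρ.trace = 1

/-- The reduced state `ρ_A = Tr_B ρ`. -/
def redA {d : ℕ} (ρ : Matrix (Fin d × Fin d) (Fin d × Fin d) ℂ) : Matrix (Fin d) (Fin d) ℂ :=
  Matrix.of fun a a' => ∑ b, ρ (a, b) (a', b)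

/-- The reduced state `ρ_B = Tr_A ρ`. -/
def redB {d : ℕ} (ρ : Matrix (Fin d × Fin d) (Fin d × Fin d) ℂ) : Matrix (Fin d) (Fin d) ℂ :=
  Matrix.of fun b b' => ∑ a, ρ (a, b) (a, b')

/-- The partial transpose `ρ^{T_A}`. -/
def ptA {d : ℕ} (ρ : Matrix (Fin d × Fin d) (Fin d × Fin d) ℂ) :
    Matrix (Fin d × Fin d) (Fin d × Fin d) ℂ :=
  Matrix.of fun x y => ρ (y.1, x.2) (x.1, y.2)

/-- An operator on `(ℂ^d)_A^{⊗3} ⊗ (ℂ^d)_B^{⊗3}` regarded as an operator on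
`((ℂ^d)_A ⊗ (ℂ^d)_B)^{⊗3}`, by regrouping the tensor factors. -/
def regroup {d : ℕ}
    (X : Matrix ((Fin 3 → Fin d) × (Fin 3 → Fin d)) ((Fin 3 → Fin d) × (Fin 3 → Fin d)) ℂ) :
    Matrix (Fin 3 → Fin d × Fin d) (Fin 3 → Fin d × Fin d) ℂ :=
  Matrix.of fun s t => X (fun i => (s i).1, fun i => (s i).2) (fun i => (t i).1, fun i => (t i).2)

end BilocalTwirl

end

namespace BilocalTwirl

/-! By the design property both twirls are Haar twirls. The Haar twirl of O₊² commutes with every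
V⊗V⊗V, by invariance of the measure, and with permutations of the three factors, because O₊ does.
Such an operator is x·1 + y·(sum of transpositions) + z·(sum of 3-cycles); this is the case of
Schur-Weyl duality proved in `exists_eq_classOp`.

That case needs no representation theory. A factor-symmetric T is determined, by polarization, by
the numbers Tr(T H⊗H⊗H) with H Hermitian. Diagonalizing H and absorbing the eigenbasis into T shows
that these numbers depend only on the diagonal of T in the standard basis. Since T commutes with
permutation matrices, its diagonal depends only on which letters of a string coincide, and the
diagonals of permutation operators span all such functions. Subtracting the class operator whose
symmetrized diagonal matches that of T therefore leaves zero.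

The coefficients are found by comparing traces against permutation operators, which twirling
preserves and which are easy for a diagonal observable. For d ≤ 2 the permutation operators are
linearly dependent, so x, y, z cannot be solved for. The operator is nevertheless determined: a
class operator with zero trace against every permutation has zero Hilbert-Schmidt norm
(`classOp_eq_zero`).

Finally (P_σ ⊗ P_τ) is evaluated on ρ⊗ρ⊗ρ. Relabelling the copies shows that the value depends only
on the simultaneous conjugacy class of (σ, τ). The 36 pairs form 11 classes; their sizes and traces
give the formula (`bilocalTrace_classOp`). -/

/-- The operator permuting the tensor factors of `(ℂ^n)^{⊗k}` according to `σ`. -/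
def permOp (n : Type*) [DecidableEq n] {k : ℕ} (σ : Equiv.Perm (Fin k)) :
    Matrix (Fin k → n) (Fin k → n) ℂ :=
  Matrix.of fun a b => if a ∘ σ = b then 1 else 0

/-! ### Tensor powers and permutations of the factors -/

section TensorPow

variable {n : Type*} {k : ℕ}

theorem tensorPow_mul [Fintype n] (M N : Matrix n n ℂ) :
    tensorPow k (M * N) = tensorPow k M * tensorPow k N := by
  classical
  ext a b
  simp only [tensorPow, of_apply, mul_apply, Finset.prod_univ_sum, Fintype.piFinset_univ,
    Finset.prod_mul_distrib]

theorem tensorPow_one [DecidableEq n] : tensorPow k (1 : Matrix n n ℂ) = 1 := by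
  ext a b
  by_cases h : a = b
  · subst h; simp [tensorPow]
  · obtain ⟨i, hi⟩ := Function.ne_iff.1 h
    rw [one_apply_ne h]
    exact Finset.prod_eq_zero (Finset.mem_univ i) (one_apply_ne hi)

theorem tensorPow_conjTranspose (M : Matrix n n ℂ) :
    tensorPow k Mᴴ = (tensorPow k M)ᴴ := by
  ext a b
  simp [tensorPow, conjTranspose_apply]

theorem tensorPow_comp_perm (M : Matrix n n ℂ) (σ : Equiv.Perm (Fin k)) (a b : Fin k → n) :
    tensorPow k M (a ∘ σ) (b ∘ σ) = tensorPow k M a b :=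
  Equiv.prod_comp σ fun i => M (a i) (b i)

variable [DecidableEq n]

theorem permOp_one : permOp n (1 : Equiv.Perm (Fin k)) = 1 := by
  ext a b
  simp [permOp, one_apply]

theorem permOp_conjTranspose (σ : Equiv.Perm (Fin k)) :
    (permOp n σ)ᴴ = permOp n σ⁻¹ := by
  ext a b
  have h : b ∘ σ = a ↔ a ∘ σ.symm = b := by
    rw [Equiv.comp_symm_eq, eq_comm]
  have h' : a ∘ ⇑σ⁻¹ = a ∘ σ.symm := rfl
  simp only [permOp, conjTranspose_apply, of_apply, h, h']
  split_ifs <;> simp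

variable [Fintype n]

theorem permOp_mul_apply (σ : Equiv.Perm (Fin k)) (Y : Matrix (Fin k → n) (Fin k → n) ℂ)
    (a b : Fin k → n) : (permOp n σ * Y) a b = Y (a ∘ σ) b := by
  simp [permOp, mul_apply]

theorem mul_permOp_apply (σ : Equiv.Perm (Fin k)) (Y : Matrix (Fin k → n) (Fin k → n) ℂ)
    (a b : Fin k → n) : (Y * permOp n σ) a b = Y a (b ∘ σ.symm) := by
  have h (c : Fin k → n) : c ∘ σ = b ↔ c = b ∘ σ.symm := by
    rw [Equiv.eq_comp_symm]
  simp [permOp, mul_apply, h]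

theorem permOp_mul (σ τ : Equiv.Perm (Fin k)) :
    permOp n σ * permOp n τ = permOp n (σ * τ) := by
  ext a b
  rw [permOp_mul_apply]
  rfl

theorem commute_permOp_iff (σ : Equiv.Perm (Fin k)) (Y : Matrix (Fin k → n) (Fin k → n) ℂ) :
    Commute (permOp n σ) Y ↔ ∀ a b, Y (a ∘ σ) (b ∘ σ) = Y a b := by
  constructor
  · intro h a b
    have := congrFun₂ h.eq a (b ∘ σ)
    rw [permOp_mul_apply, mul_permOp_apply] at this
    rw [this]
    congr 1
    ext i; simp
  · intro h
    ext a b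
    rw [permOp_mul_apply, mul_permOp_apply, ← h a]
    congr 1
    ext i; simp

theorem commute_permOp_tensorPow (σ : Equiv.Perm (Fin k)) (M : Matrix n n ℂ) :
    Commute (permOp n σ) (tensorPow k M) :=
  (commute_permOp_iff σ _).2 (tensorPow_comp_perm M σ)

theorem trace_mul_tensorPow_diagonal (Y : Matrix (Fin k → n) (Fin k → n) ℂ) (l : n → ℂ) :
    (Y * tensorPow k (diagonal l)).trace = ∑ a, Y a a * ∏ i, l (a i) := by
  have h : tensorPow k (diagonal l) = diagonal fun a : Fin k → n => ∏ i, l (a i) := by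
    ext a b
    by_cases h : a = b
    · subst h; simp [tensorPow]
    · obtain ⟨i, hi⟩ := Function.ne_iff.1 h
      rw [diagonal_apply_ne _ h]
      exact Finset.prod_eq_zero (Finset.mem_univ i) (diagonal_apply_ne _ hi)
  simp [h, trace, mul_diagonal]

end TensorPow

/-! ### Symmetries of the Haar twirl -/

section Haar

variable {d k : ℕ}

instance : IsProbabilityMeasure (haarU d) :=
  ⟨by simpa [haarU] using Measure.haarMeasure_self (G := U d) (K₀ := ⊤)⟩

instance : (haarU d).IsMulLeftInvariant := by
  unfold haarU; infer_instance

/-- The conjugate `V^{⊗k} X (V†)^{⊗k}` of an operator `X`. -/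
def conjPow (k : ℕ) (V : Matrix (Fin d) (Fin d) ℂ)
    (X : Matrix (Fin k → Fin d) (Fin k → Fin d) ℂ) :
    Matrix (Fin k → Fin d) (Fin k → Fin d) ℂ :=
  tensorPow k V * X * tensorPow k Vᴴ

theorem twirl_apply (μ : Measure (U d)) (X : Matrix (Fin k → Fin d) (Fin k → Fin d) ℂ)
    (a b : Fin k → Fin d) : twirl k μ X a b = ∫ V : U d, conjPow k (V : Matrix _ _ ℂ) X a b ∂μ := by
  simp only [twirl, of_apply, conjPow, tensorPow_conjTranspose]

theorem continuous_tensorPow_apply (a b : Fin k → Fin d) :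
    Continuous fun V : U d => tensorPow k (V : Matrix (Fin d) (Fin d) ℂ) a b := by
  simp only [tensorPow, of_apply]
  exact continuous_finsetProd _ fun i _ => continuous_subtype_val.matrix_elem (a i) (b i)

theorem integrable_conjPow (X : Matrix (Fin k → Fin d) (Fin k → Fin d) ℂ) (a b : Fin k → Fin d) :
    Integrable (fun V : U d => conjPow k (V : Matrix _ _ ℂ) X a b) (haarU d) := by
  have h : Continuous fun V : U d => conjPow k (V : Matrix _ _ ℂ) X a b := by
    simp only [conjPow, tensorPow_conjTranspose, mul_apply, conjTranspose_apply]
    exact continuous_finsetSum _ fun c _ =>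
      (continuous_finsetSum _ fun e _ => (continuous_tensorPow_apply _ _).mul
        continuous_const).mul (continuous_tensorPow_apply _ _).star
  exact h.integrable_of_hasCompactSupport (HasCompactSupport.of_compactSpace _)

/-- Linear functionals pass under the entrywise integral; traces and conjugations of the twirl are
computed through this. -/
theorem sum_mul_twirl (X : Matrix (Fin k → Fin d) (Fin k → Fin d) ℂ)
    (L : (Fin k → Fin d) → (Fin k → Fin d) → ℂ) :
    ∑ a, ∑ b, L a b * twirl k (haarU d) X a b =
      ∫ V : U d, ∑ a, ∑ b, L a b * conjPow k (V : Matrix _ _ ℂ) X a b ∂(haarU d) := by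
  rw [integral_finsetSum _ fun a _ => integrable_finsetSum _ fun b _ =>
    (integrable_conjPow X a b).const_mul _]
  refine Finset.sum_congr rfl fun a _ => ?_
  rw [integral_finsetSum _ fun b _ => (integrable_conjPow X a b).const_mul _]
  refine Finset.sum_congr rfl fun b _ => ?_
  rw [integral_const_mul, twirl_apply]

theorem tensorPow_star_mul_unitary (W : U d) :
    tensorPow k (W : Matrix (Fin d) (Fin d) ℂ)ᴴ * tensorPow k (W : Matrix (Fin d) (Fin d) ℂ)
      = 1 := by
  rw [← tensorPow_mul, ← star_eq_conjTranspose, mem_unitaryGroup_iff'.1 W.2, tensorPow_one]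

/-- Conjugating by W⊗…⊗W replaces V by WV in the integrand, which left invariance undoes. -/
theorem conjPow_twirl (W : U d) (X : Matrix (Fin k → Fin d) (Fin k → Fin d) ℂ) :
    conjPow k (W : Matrix _ _ ℂ) (twirl k (haarU d) X) = twirl k (haarU d) X := by
  ext a b
  have hsum (Y : Matrix (Fin k → Fin d) (Fin k → Fin d) ℂ) :
      conjPow k (W : Matrix _ _ ℂ) Y a b = ∑ c, ∑ e,
        (tensorPow k (W : Matrix _ _ ℂ) a c * tensorPow k (W : Matrix _ _ ℂ)ᴴ e b) * Y c e := by
    simp only [conjPow, mul_apply, Finset.sum_mul]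
    rw [Finset.sum_comm]
    refine Finset.sum_congr rfl fun c _ => Finset.sum_congr rfl fun e _ => by ring
  rw [hsum, sum_mul_twirl, twirl_apply]
  simp only [← hsum]
  rw [← integral_mul_left_eq_self (fun V : U d => conjPow k (V : Matrix _ _ ℂ) X a b) W]
  congr 1
  ext V
  simp only [conjPow, Submonoid.coe_mul, conjTranspose_mul, tensorPow_mul, Matrix.mul_assoc]

theorem commute_tensorPow_twirl (W : U d) (X : Matrix (Fin k → Fin d) (Fin k → Fin d) ℂ) :
    Commute (tensorPow k (W : Matrix (Fin d) (Fin d) ℂ)) (twirl k (haarU d) X) := by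
  have h := congrArg (· * tensorPow k (W : Matrix (Fin d) (Fin d) ℂ)) (conjPow_twirl W X)
  show _ = _
  simpa only [conjPow, Matrix.mul_assoc, tensorPow_star_mul_unitary, Matrix.mul_one] using h

theorem commute_permOp_twirl {X : Matrix (Fin k → Fin d) (Fin k → Fin d) ℂ}
    {σ : Equiv.Perm (Fin k)} (h : Commute (permOp (Fin d) σ) X) :
    Commute (permOp (Fin d) σ) (twirl k (haarU d) X) := by
  rw [commute_permOp_iff]
  intro a b
  rw [twirl_apply, twirl_apply]
  congr 1
  ext V
  exact (commute_permOp_iff σ _).1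
    (((commute_permOp_tensorPow σ _).mul_right h).mul_right (commute_permOp_tensorPow σ _)) a b

/-- The permutation commutes with the tensor power of V, so by cyclicity V cancels V† and the
integrand is constant. -/
theorem trace_twirl_mul_permOp (X : Matrix (Fin k → Fin d) (Fin k → Fin d) ℂ)
    (σ : Equiv.Perm (Fin k)) :
    (twirl k (haarU d) X * permOp (Fin d) σ).trace = (X * permOp (Fin d) σ).trace := by
  have hsum (Y : Matrix (Fin k → Fin d) (Fin k → Fin d) ℂ) :
      (Y * permOp (Fin d) σ).trace = ∑ a, ∑ b, permOp (Fin d) σ b a * Y a b := by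
    simp only [trace, diag_apply, mul_apply, mul_comm]
  rw [hsum, sum_mul_twirl]
  simp only [← hsum]
  have h (V : U d) : (conjPow k (V : Matrix _ _ ℂ) X * permOp (Fin d) σ).trace =
      (X * permOp (Fin d) σ).trace := by
    rw [conjPow, Matrix.mul_assoc, ← (commute_permOp_tensorPow σ _).eq, Matrix.mul_assoc,
      trace_mul_comm, Matrix.mul_assoc, Matrix.mul_assoc, tensorPow_star_mul_unitary,
      Matrix.mul_one]
  simp [h]

end Haar

end BilocalTwirl

namespace BilocalTwirl

/-! ### Diagonals invariant under relabelling of letters -/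

section Diagonal

variable {d k : ℕ}

/-- The unitary permuting the basis vectors according to `π`. -/
def permUnitary (π : Equiv.Perm (Fin d)) : U d :=
  ⟨Matrix.of fun a b => if π a = b then 1 else 0, by
    rw [mem_unitaryGroup_iff]
    ext a b
    simp [mul_apply, star_eq_conjTranspose, conjTranspose_apply, one_apply, eq_comm]⟩

theorem tensorPow_permUnitary_apply (π : Equiv.Perm (Fin d)) (a b : Fin k → Fin d) :
    tensorPow k (permUnitary π : Matrix (Fin d) (Fin d) ℂ) a b = if π ∘ a = b then 1 else 0 := by
  split_ifs with h
  · subst h; simp [tensorPow, permUnitary]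
  · obtain ⟨i, hi⟩ := Function.ne_iff.1 h
    exact Finset.prod_eq_zero (Finset.mem_univ i) (by simpa [permUnitary] using hi)

theorem apply_perm_comp {T : Matrix (Fin k → Fin d) (Fin k → Fin d) ℂ}
    (hT : ∀ W : U d, Commute (tensorPow k (W : Matrix (Fin d) (Fin d) ℂ)) T)
    (π : Equiv.Perm (Fin d)) (a b : Fin k → Fin d) : T (π ∘ a) (π ∘ b) = T a b := by
  have h := congrFun₂ (hT (permUnitary π)).eq a (π ∘ b)
  have hinj (c : Fin k → Fin d) : π ∘ c = π ∘ b ↔ c = b :=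
    ⟨fun h => by funext i; exact π.injective (congrFun h i), fun h => h ▸ rfl⟩
  simpa [mul_apply, tensorPow_permUnitary_apply, hinj] using h

/-- The correspondence a i ↦ b i is a well-defined bijection between the two ranges, and on a finite
type it extends to a permutation. -/
theorem exists_perm_comp_eq {ι α : Type*} [Fintype α] {a b : ι → α}
    (h : ∀ i j, a i = a j ↔ b i = b j) : ∃ π : Equiv.Perm α, π ∘ a = b := by
  classical
  have hfac : ∃ f : Set.range a → Set.range b, ∀ i, f ⟨a i, i, rfl⟩ = ⟨b i, i, rfl⟩ := by
    refine ⟨fun x => ⟨b x.2.choose, _, rfl⟩, fun i => Subtype.ext ?_⟩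
    exact (h _ _).1 (Exists.choose_spec (⟨i, rfl⟩ : ∃ y, a y = a i))
  obtain ⟨f, hf⟩ := hfac
  have hbij : Function.Bijective f := by
    constructor
    · rintro ⟨_, i, rfl⟩ ⟨_, j, rfl⟩ hij
      rw [hf, hf] at hij
      exact Subtype.ext ((h i j).2 (congrArg Subtype.val hij))
    · rintro ⟨_, i, rfl⟩
      exact ⟨_, hf i⟩
  refine ⟨(Equiv.ofBijective f hbij).extendSubtype, funext fun i => ?_⟩
  rw [Function.comp_apply, Equiv.extendSubtype_apply_of_mem _ _ ⟨i, rfl⟩]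
  exact congrArg Subtype.val (hf i)

/-- A function of triples which depends only on which of the entries coincide. -/
theorem exists_coeff_of_perm_invariant {α : Type*} [Fintype α] [DecidableEq α]
    {t : (Fin 3 → α) → ℂ} (ht : ∀ (π : Equiv.Perm α) (a : Fin 3 → α), t (π ∘ a) = t a) :
    ∃ c c₀₁ c₁₂ c₀₂ e : ℂ, ∀ a, t a = c + c₀₁ * (if a 0 = a 1 then 1 else 0)
      + c₁₂ * (if a 1 = a 2 then 1 else 0) + c₀₂ * (if a 0 = a 2 then 1 else 0)
      + e * (if a 0 = a 1 ∧ a 1 = a 2 then 1 else 0) := by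
  have hfac : Function.FactorsThrough t
      fun a => ((a 0 = a 1 : Bool), (a 1 = a 2 : Bool), (a 0 = a 2 : Bool)) := by
    intro a b hab
    simp only [Prod.mk.injEq, decide_eq_decide] at hab
    obtain ⟨h₁, h₂, h₃⟩ := hab
    obtain ⟨π, rfl⟩ := exists_perm_comp_eq (a := a) (b := b) (by
      intro i j
      fin_cases i <;> fin_cases j <;> simp [h₁, h₂, h₃, eq_comm (a := a 1) (b := a 0),
        eq_comm (a := b 1) (b := b 0), eq_comm (a := a 2), eq_comm (a := b 2)])
    exact (ht π a).symm
  obtain ⟨g, hg⟩ := (Function.factorsThrough_iff t).1 hfac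
  -- Möbius inversion over the five partitions of the three positions. Patterns with exactly two
  -- equalities never occur, and for small alphabets some of the values of `g` used here are
  -- arbitrary.
  refine ⟨g (false, false, false), g (true, false, false) - g (false, false, false),
    g (false, true, false) - g (false, false, false),
    g (false, false, true) - g (false, false, false),
    g (true, true, true) - g (true, false, false) - g (false, true, false)
      - g (false, false, true) + 2 * g (false, false, false), fun a => ?_⟩
  rw [hg, Function.comp_apply]
  by_cases h₁ : a 0 = a 1
  · by_cases h₂ : a 1 = a 2
    · simp [h₁, h₂]; ring
    · simp [h₁, h₂]
  · by_cases h₂ : a 1 = a 2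
    · have h₃ : a 0 ≠ a 2 := h₂ ▸ h₁
      simp [h₂, h₃]
    · by_cases h₃ : a 0 = a 2
      · have : a 2 ≠ a 1 := fun h => h₂ h.symm
        simp [h₂, h₃, this]
      · simp [h₁, h₂, h₃]

end Diagonal

/-! ### Class operators and the diagonals of permutation operators -/

section Span

variable {n : Type*} [DecidableEq n]

/-- The combination of permutation operators with coefficients `x` on the identity, `y` on the
three transpositions and `z` on the two cycles. -/
def classOp (n : Type*) [DecidableEq n] (x y z : ℂ) : Matrix (Fin 3 → n) (Fin 3 → n) ℂ :=
  x • permOp n 1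
    + y • (permOp n (Equiv.swap 0 1) + permOp n (Equiv.swap 1 2) + permOp n (Equiv.swap 0 2))
    + z • (permOp n (finRotate 3) + permOp n (finRotate 3)⁻¹)

theorem comp_swap₀₁ {α : Type*} (a : Fin 3 → α) : a ∘ Equiv.swap 0 1 = ![a 1, a 0, a 2] := by
  ext i; fin_cases i <;> rfl

theorem comp_swap₁₂ {α : Type*} (a : Fin 3 → α) : a ∘ Equiv.swap 1 2 = ![a 0, a 2, a 1] := by
  ext i; fin_cases i <;> rfl

theorem comp_swap₀₂ {α : Type*} (a : Fin 3 → α) : a ∘ Equiv.swap 0 2 = ![a 2, a 1, a 0] := by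
  ext i; fin_cases i <;> rfl

theorem comp_finRotate {α : Type*} (a : Fin 3 → α) : a ∘ finRotate 3 = ![a 1, a 2, a 0] := by
  ext i; fin_cases i <;> rfl

theorem comp_finRotate_inv {α : Type*} (a : Fin 3 → α) :
    a ∘ ⇑(finRotate 3)⁻¹ = ![a 2, a 0, a 1] := by
  ext i; fin_cases i <;> rfl

/-- A diagonal entry tests whether the string is constant on the cycles of the permutation; hence
both 3-cycles have the same diagonal. -/
theorem permOp_swap₀₁_diag (a : Fin 3 → n) :
    permOp n (Equiv.swap 0 1) a a = if a 0 = a 1 then 1 else 0 := by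
  simp only [permOp, of_apply, comp_swap₀₁, funext_iff, Fin.forall_fin_succ]
  congr 1; simp; exact fun h => h.symm

theorem permOp_swap₁₂_diag (a : Fin 3 → n) :
    permOp n (Equiv.swap 1 2) a a = if a 1 = a 2 then 1 else 0 := by
  simp only [permOp, of_apply, comp_swap₁₂, funext_iff, Fin.forall_fin_succ]
  congr 1; simp; exact fun h => h.symm

theorem permOp_swap₀₂_diag (a : Fin 3 → n) :
    permOp n (Equiv.swap 0 2) a a = if a 0 = a 2 then 1 else 0 := by
  simp only [permOp, of_apply, comp_swap₀₂, funext_iff, Fin.forall_fin_succ]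
  congr 1; simp; exact fun h => h.symm

theorem permOp_finRotate_diag (a : Fin 3 → n) :
    permOp n (finRotate 3) a a = if a 0 = a 1 ∧ a 1 = a 2 then 1 else 0 := by
  simp only [permOp, of_apply, comp_finRotate, funext_iff, Fin.forall_fin_succ]
  congr 1; simp; grind

theorem permOp_finRotate_inv_diag (a : Fin 3 → n) :
    permOp n (finRotate 3)⁻¹ a a = if a 0 = a 1 ∧ a 1 = a 2 then 1 else 0 := by
  simp only [permOp, of_apply, comp_finRotate_inv, funext_iff, Fin.forall_fin_succ]
  congr 1; simp; grind

theorem permOp_one_diag {k : ℕ} (a : Fin k → n) : permOp n 1 a a = 1 := by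
  simp [permOp]

end Span

end BilocalTwirl

namespace BilocalTwirl

/-! ### Polarization -/

section Polarization

variable {n : Type*} [Fintype n]

/-- The trilinear form `(M₁, M₂, M₃) ↦ Tr[T (M₁ ⊗ M₂ ⊗ M₃)]`. -/
def triForm (T : Matrix (Fin 3 → n) (Fin 3 → n) ℂ) (M₁ M₂ M₃ : Matrix n n ℂ) : ℂ :=
  ∑ a, ∑ b, T a b * (M₁ (b 0) (a 0) * M₂ (b 1) (a 1) * M₃ (b 2) (a 2))

variable {T : Matrix (Fin 3 → n) (Fin 3 → n) ℂ}

theorem trace_mul_tensorPow_three (M : Matrix n n ℂ) :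
    (T * tensorPow 3 M).trace = triForm T M M M := by
  simp [triForm, trace, mul_apply, tensorPow, Fin.prod_univ_three]

theorem triForm_add (M N M₂ M₃ : Matrix n n ℂ) :
    triForm T (M + N) M₂ M₃ = triForm T M M₂ M₃ + triForm T N M₂ M₃ := by
  simp only [triForm, Matrix.add_apply, add_mul, mul_add, Finset.sum_add_distrib]

theorem triForm_smul (c : ℂ) (M M₂ M₃ : Matrix n n ℂ) :
    triForm T (c • M) M₂ M₃ = c * triForm T M M₂ M₃ := by
  simp only [triForm, Matrix.smul_apply, smul_eq_mul, Finset.mul_sum]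
  exact Finset.sum_congr rfl fun a _ => Finset.sum_congr rfl fun b _ => by ring

theorem sum_sum_comp_perm {k : ℕ} (σ : Equiv.Perm (Fin k)) (F : (Fin k → n) → (Fin k → n) → ℂ) :
    ∑ a, ∑ b, F (a ∘ σ) (b ∘ σ) = ∑ a, ∑ b, F a b := by
  let e : (Fin k → n) ≃ (Fin k → n) := Equiv.arrowCongr σ.symm (Equiv.refl n)
  rw [← Equiv.sum_comp e fun a => ∑ b, F a b]
  refine Finset.sum_congr rfl fun a _ => ?_
  rw [← Equiv.sum_comp e fun b => F (e a) b]
  rfl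

variable [DecidableEq n]

theorem triForm_swap₀₁ (hT : Commute (permOp n (Equiv.swap 0 1)) T) (M₁ M₂ M₃ : Matrix n n ℂ) :
    triForm T M₁ M₂ M₃ = triForm T M₂ M₁ M₃ := by
  rw [triForm, ← sum_sum_comp_perm (Equiv.swap 0 1), triForm]
  refine Finset.sum_congr rfl fun a _ => Finset.sum_congr rfl fun b _ => ?_
  rw [(commute_permOp_iff _ T).1 hT]
  simp only [comp_swap₀₁, cons_val]
  ring

theorem triForm_swap₁₂ (hT : Commute (permOp n (Equiv.swap 1 2)) T) (M₁ M₂ M₃ : Matrix n n ℂ) :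
    triForm T M₁ M₂ M₃ = triForm T M₁ M₃ M₂ := by
  rw [triForm, ← sum_sum_comp_perm (Equiv.swap 1 2), triForm]
  refine Finset.sum_congr rfl fun a _ => Finset.sum_congr rfl fun b _ => ?_
  rw [(commute_permOp_iff _ T).1 hT]
  simp only [comp_swap₁₂, cons_val]
  ring

/-- A permutation-invariant operator on the third tensor power vanishes if its expectation values
on all third powers of Hermitian matrices vanish. -/
theorem eq_zero_of_trace_mul_tensorPow_eq_zero
    (h₀₁ : Commute (permOp n (Equiv.swap 0 1)) T) (h₁₂ : Commute (permOp n (Equiv.swap 1 2)) T)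
    (h : ∀ H : Matrix n n ℂ, H.IsHermitian → (T * tensorPow 3 H).trace = 0) : T = 0 := by
  have s₁ := triForm_swap₀₁ h₀₁
  have s₂ := triForm_swap₁₂ h₁₂
  have add₂ (M N M₁ M₃ : Matrix n n ℂ) :
      triForm T M₁ (M + N) M₃ = triForm T M₁ M M₃ + triForm T M₁ N M₃ := by
    rw [s₁, triForm_add, s₁ M, s₁ N]
  have add₃ (M N M₁ M₂ : Matrix n n ℂ) :
      triForm T M₁ M₂ (M + N) = triForm T M₁ M₂ M + triForm T M₁ M₂ N := by
    rw [s₂, add₂, s₂ M₁ M, s₂ M₁ N]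
  have smul₂ (c : ℂ) (M M₁ M₃ : Matrix n n ℂ) :
      triForm T M₁ (c • M) M₃ = c * triForm T M₁ M M₃ := by
    rw [s₁, triForm_smul, s₁ M]
  have smul₃ (c : ℂ) (M M₁ M₂ : Matrix n n ℂ) :
      triForm T M₁ M₂ (c • M) = c * triForm T M₁ M₂ M := by
    rw [s₂, smul₂, s₂ M₁ M]
  have cube {H : Matrix n n ℂ} (hH : H.IsHermitian) : triForm T H H H = 0 := by
    rw [← trace_mul_tensorPow_three, h H hH]
  have square {H K : Matrix n n ℂ} (hH : H.IsHermitian) (hK : K.IsHermitian) :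
      triForm T H H K = 0 := by
    -- The difference of the cubes of H + K and H - K isolates the terms odd in K; the K-cube
    -- vanishes and symmetry identifies the other three.
    have e₁ := cube (hH.add hK)
    have e₂ := cube (hH.sub hK)
    rw [sub_eq_add_neg, ← neg_one_smul ℂ K] at e₂
    simp only [triForm_add, add₂, add₃, triForm_smul, smul₂, smul₃, cube hH, cube hK] at e₁ e₂
    have r₁ := s₂ H K H
    have r₂ := s₁ K H H
    linear_combination (e₁ - e₂) / 6 - (2 * r₁ + r₂) / 3
  have mixed {H K L : Matrix n n ℂ} (hH : H.IsHermitian) (hK : K.IsHermitian)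
      (hL : L.IsHermitian) : triForm T H K L = 0 := by
    have e := square (hH.add hK) hL
    simp only [triForm_add, add₂, square hH hL, square hK hL, s₁ K H L] at e
    linear_combination e / 2
  have decomp (M : Matrix n n ℂ) : ∃ H K : Matrix n n ℂ, H.IsHermitian ∧ K.IsHermitian ∧
      M = H + Complex.I • K :=
    ⟨realPart M, imaginaryPart M, (realPart M).2, (imaginaryPart M).2,
      (realPart_add_I_smul_imaginaryPart M).symm⟩
  have all (M₁ M₂ M₃ : Matrix n n ℂ) : triForm T M₁ M₂ M₃ = 0 := by
    obtain ⟨H₁, K₁, hH₁, hK₁, rfl⟩ := decomp M₁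
    obtain ⟨H₂, K₂, hH₂, hK₂, rfl⟩ := decomp M₂
    obtain ⟨H₃, K₃, hH₃, hK₃, rfl⟩ := decomp M₃
    simp only [triForm_add, add₂, add₃, triForm_smul, smul₂, smul₃, mixed, hH₁, hK₁, hH₂, hK₂, hH₃, hK₃]
    simp
  ext a b
  -- On these matrix units the trilinear form has a single surviving term, the entry of T at (a, b).
  have e := all (single (b 0) (a 0) 1) (single (b 1) (a 1) 1) (single (b 2) (a 2) 1)
  rw [triForm, Finset.sum_eq_single a, Finset.sum_eq_single b] at e
  · simpa using e
  · intro b' _ hb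
    obtain ⟨i, hi⟩ := Function.ne_iff.1 hb
    have hz : single (b i) (a i) (1 : ℂ) (b' i) (a i) = 0 := by
      simp [Ne.symm hi]
    fin_cases i <;> (simp only [Fin.zero_eta, Fin.mk_one, Fin.reduceFinMk] at hz; simp [hz])
  · simp
  · intro a' _ ha
    obtain ⟨i, hi⟩ := Function.ne_iff.1 ha
    have hz (b' : Fin 3 → n) : single (b i) (a i) (1 : ℂ) (b' i) (a' i) = 0 := by
      simp [Ne.symm hi]
    refine Finset.sum_eq_zero fun b' _ => ?_
    replace hz := hz b'
    fin_cases i <;> (simp only [Fin.zero_eta, Fin.mk_one, Fin.reduceFinMk] at hz; simp [hz])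
  · simp

end Polarization

/-! ### Traces depend only on the conjugacy class -/

section PermTrace

variable {n : Type*} [Fintype n] [DecidableEq n]

theorem trace_permOp_conj_mul {k : ℕ} (σ τ : Equiv.Perm (Fin k))
    {Y : Matrix (Fin k → n) (Fin k → n) ℂ} (hY : Commute (permOp n σ) Y) :
    (permOp n (σ * τ * σ⁻¹) * Y).trace = (permOp n τ * Y).trace := by
  rw [← permOp_mul, ← permOp_mul, Matrix.mul_assoc, Matrix.mul_assoc, trace_mul_comm,
    Matrix.mul_assoc, Matrix.mul_assoc, ← hY.eq, ← Matrix.mul_assoc (permOp n σ⁻¹), permOp_mul,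
    inv_mul_cancel, permOp_one, Matrix.one_mul]

theorem trace_permOp_swap₁₂_mul {Y : Matrix (Fin 3 → n) (Fin 3 → n) ℂ}
    (hY : Commute (permOp n (Equiv.swap 0 2)) Y) :
    (permOp n (Equiv.swap 1 2) * Y).trace = (permOp n (Equiv.swap 0 1) * Y).trace := by
  rw [← trace_permOp_conj_mul _ _ hY]
  congr 3
  decide

theorem trace_permOp_swap₀₂_mul {Y : Matrix (Fin 3 → n) (Fin 3 → n) ℂ}
    (hY : Commute (permOp n (Equiv.swap 1 2)) Y) :
    (permOp n (Equiv.swap 0 2) * Y).trace = (permOp n (Equiv.swap 0 1) * Y).trace := by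
  rw [← trace_permOp_conj_mul _ _ hY]
  congr 3
  decide

theorem trace_permOp_finRotate_inv_mul {Y : Matrix (Fin 3 → n) (Fin 3 → n) ℂ}
    (hY : Commute (permOp n (Equiv.swap 0 1)) Y) :
    (permOp n (finRotate 3)⁻¹ * Y).trace = (permOp n (finRotate 3) * Y).trace := by
  rw [← trace_permOp_conj_mul _ _ hY]
  congr 3
  decide

theorem commute_permOp_swap₀₁_classOp (x y z : ℂ) :
    Commute (permOp n (Equiv.swap 0 1)) (classOp n x y z) := by
  have h₁ : Equiv.swap 0 1 * Equiv.swap 1 2 = Equiv.swap 0 2 * Equiv.swap (0 : Fin 3) 1 := by decide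
  have h₂ : Equiv.swap 0 1 * Equiv.swap 0 2 = Equiv.swap 1 2 * Equiv.swap (0 : Fin 3) 1 := by decide
  have h₃ : Equiv.swap 0 1 * finRotate 3 = (finRotate 3)⁻¹ * Equiv.swap (0 : Fin 3) 1 := by decide
  have h₄ : Equiv.swap 0 1 * (finRotate 3)⁻¹ = finRotate 3 * Equiv.swap (0 : Fin 3) 1 := by decide
  show _ = _
  simp only [classOp, Matrix.mul_add, Matrix.add_mul, Matrix.mul_smul, Matrix.smul_mul, permOp_mul, h₁, h₂, h₃,
    h₄, one_mul, mul_one]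
  module

theorem commute_permOp_swap₁₂_classOp (x y z : ℂ) :
    Commute (permOp n (Equiv.swap 1 2)) (classOp n x y z) := by
  have h₁ : Equiv.swap 1 2 * Equiv.swap 0 1 = Equiv.swap 0 2 * Equiv.swap (1 : Fin 3) 2 := by decide
  have h₂ : Equiv.swap 1 2 * Equiv.swap 0 2 = Equiv.swap 0 1 * Equiv.swap (1 : Fin 3) 2 := by decide
  have h₃ : Equiv.swap 1 2 * finRotate 3 = (finRotate 3)⁻¹ * Equiv.swap (1 : Fin 3) 2 := by decide
  have h₄ : Equiv.swap 1 2 * (finRotate 3)⁻¹ = finRotate 3 * Equiv.swap (1 : Fin 3) 2 := by decide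
  show _ = _
  simp only [classOp, Matrix.mul_add, Matrix.add_mul, Matrix.mul_smul, Matrix.smul_mul, permOp_mul, h₁, h₂, h₃,
    h₄, one_mul, mul_one]
  module

end PermTrace

/-! ### The commutant on three factors -/

section Commutant

variable {d : ℕ}

/-- The unitary diagonalizing H commutes past T and cancels under the trace, so only the standard
diagonal of T enters. -/
theorem trace_mul_tensorPow_hermitian {k : ℕ} {T : Matrix (Fin k → Fin d) (Fin k → Fin d) ℂ}
    (hT : ∀ W : U d, Commute (tensorPow k (W : Matrix (Fin d) (Fin d) ℂ)) T)
    {H : Matrix (Fin d) (Fin d) ℂ} (hH : H.IsHermitian) :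
    (T * tensorPow k H).trace = ∑ a, T a a * ∏ i, (hH.eigenvalues (a i) : ℂ) := by
  have hspec : H = (hH.eigenvectorUnitary : Matrix _ _ ℂ)
      * diagonal (fun i => (hH.eigenvalues i : ℂ)) * (hH.eigenvectorUnitary : Matrix _ _ ℂ)ᴴ := by
    exact hH.spectral_theorem
  conv_lhs => rw [hspec]
  rw [tensorPow_mul, tensorPow_mul, ← trace_mul_tensorPow_diagonal T fun i => (hH.eigenvalues i : ℂ), ← Matrix.mul_assoc,
    trace_mul_comm, ← Matrix.mul_assoc, ← Matrix.mul_assoc, Matrix.mul_assoc _ T,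
    ← (hT hH.eigenvectorUnitary).eq, ← Matrix.mul_assoc, tensorPow_star_mul_unitary, Matrix.one_mul]

/-- The part of Schur-Weyl duality needed here: an operator on the third tensor power which commutes
with the unitaries `V ⊗ V ⊗ V` and with the permutations of the factors is a class function of the
permutation operators. -/
theorem exists_eq_classOp {T : Matrix (Fin 3 → Fin d) (Fin 3 → Fin d) ℂ}
    (hU : ∀ W : U d, Commute (tensorPow 3 (W : Matrix (Fin d) (Fin d) ℂ)) T)
    (h₀₁ : Commute (permOp (Fin d) (Equiv.swap 0 1)) T)
    (h₁₂ : Commute (permOp (Fin d) (Equiv.swap 1 2)) T) : ∃ x y z, T = classOp (Fin d) x y z := by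
  obtain ⟨c, c₀₁, c₁₂, c₀₂, e, hc⟩ := exists_coeff_of_perm_invariant (t := fun a => T a a)
    fun π a => apply_perm_comp hU π a a
  -- The three pair coefficients need not agree, nor be unique for small d, so they are averaged;
  -- the coefficient of full coincidence is shared by the two 3-cycles.
  refine ⟨c, (c₀₁ + c₁₂ + c₀₂) / 3, e / 2, ?_⟩
  have hP (σ : Equiv.Perm (Fin 3)) (W : U d) :
      Commute (tensorPow 3 (W : Matrix (Fin d) (Fin d) ℂ)) (permOp (Fin d) σ) :=
    (commute_permOp_tensorPow σ _).symm
  have hC (W : U d) : Commute (tensorPow 3 (W : Matrix (Fin d) (Fin d) ℂ))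
      (classOp (Fin d) c ((c₀₁ + c₁₂ + c₀₂) / 3) (e / 2)) :=
    (((hP _ W).smul_right _).add_right
      ((((hP _ W).add_right (hP _ W)).add_right (hP _ W)).smul_right _)).add_right
      (((hP _ W).add_right (hP _ W)).smul_right _)
  rw [← sub_eq_zero]
  refine eq_zero_of_trace_mul_tensorPow_eq_zero
    (h₀₁.sub_right (commute_permOp_swap₀₁_classOp _ _ _))
    (h₁₂.sub_right (commute_permOp_swap₁₂_classOp _ _ _)) fun H hH => ?_
  rw [trace_mul_tensorPow_hermitian (fun W => (hU W).sub_right (hC W)) hH]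
  set l : Fin d → ℂ := fun i => (hH.eigenvalues i : ℂ)
  have e₁ := trace_permOp_swap₁₂_mul (commute_permOp_tensorPow (Equiv.swap 0 2) (diagonal l))
  have e₂ := trace_permOp_swap₀₂_mul (commute_permOp_tensorPow (Equiv.swap 1 2) (diagonal l))
  simp only [trace_mul_tensorPow_diagonal, permOp_swap₀₁_diag, permOp_swap₁₂_diag,
    permOp_swap₀₂_diag] at e₁ e₂
  -- The residual pair coefficients add up to zero and multiply three equal sums, so the whole
  -- expression vanishes.
  have e₃ : ∑ a, (T - classOp (Fin d) c ((c₀₁ + c₁₂ + c₀₂) / 3) (e / 2)) a a * ∏ i, l (a i) =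
      (2 * c₀₁ - c₁₂ - c₀₂) / 3 * (∑ a : Fin 3 → Fin d, (if a 0 = a 1 then 1 else 0) * ∏ i : Fin 3, l (a i))
      + (2 * c₁₂ - c₀₁ - c₀₂) / 3 * (∑ a : Fin 3 → Fin d, (if a 1 = a 2 then 1 else 0) * ∏ i : Fin 3, l (a i))
      + (2 * c₀₂ - c₀₁ - c₁₂) / 3 * (∑ a : Fin 3 → Fin d, (if a 0 = a 2 then 1 else 0) * ∏ i : Fin 3, l (a i)) := by
    simp only [Finset.mul_sum, ← Finset.sum_add_distrib]
    refine Finset.sum_congr rfl fun a _ => ?_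
    simp only [Matrix.sub_apply, hc, classOp, Matrix.add_apply, Matrix.smul_apply, smul_eq_mul,
      permOp_swap₀₁_diag, permOp_swap₁₂_diag, permOp_swap₀₂_diag, permOp_finRotate_diag,
      permOp_finRotate_inv_diag, permOp_one_diag]
    ring
  rw [e₃, e₁, e₂]
  ring

end Commutant

end BilocalTwirl

namespace BilocalTwirl

/-! ### Traces of class operators -/

section ClassTrace

theorem classOp_sub {n : Type*} [DecidableEq n] (x y z x' y' z' : ℂ) :
    classOp n x y z - classOp n x' y' z' = classOp n (x - x') (y - y') (z - z') := by
  simp only [classOp]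
  module

variable {n : Type*} [Fintype n]

theorem sum_fin_three_arrow (F : n → n → n → ℂ) :
    ∑ a : Fin 3 → n, F (a 0) (a 1) (a 2) = ∑ x, ∑ y, ∑ z, F x y z := by
  let e : (n × n × n) ≃ (Fin 3 → n) :=
    { toFun := fun p => ![p.1, p.2.1, p.2.2]
      invFun := fun a => (a 0, a 1, a 2)
      left_inv := fun _ => rfl
      right_inv := fun a => by ext i; fin_cases i <;> rfl }
  rw [← Equiv.sum_comp e, Fintype.sum_prod_type]
  simp only [Fintype.sum_prod_type]
  rfl

variable [DecidableEq n]

/-- This and the following traces are the dimension raised to the number of cycles. -/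
theorem trace_permOp_one : (permOp n (1 : Equiv.Perm (Fin 3))).trace = (Fintype.card n : ℂ) ^ 3 := by
  simp [permOp_one, trace_one]

theorem trace_permOp_swap₀₁ : (permOp n (Equiv.swap (0 : Fin 3) 1)).trace =
    (Fintype.card n : ℂ) ^ 2 := by
  simp only [trace, diag_apply, permOp_swap₀₁_diag]
  rw [sum_fin_three_arrow fun x y _ => if x = y then 1 else 0]
  simp [sq, Finset.sum_ite_eq]

theorem trace_permOp_finRotate : (permOp n (finRotate 3)).trace = (Fintype.card n : ℂ) := by
  simp only [trace, diag_apply, permOp_finRotate_diag]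
  rw [sum_fin_three_arrow fun x y z => if x = y ∧ y = z then 1 else 0]
  simp [ite_and]

theorem trace_permOp_swap₁₂ : (permOp n (Equiv.swap (1 : Fin 3) 2)).trace =
    (Fintype.card n : ℂ) ^ 2 := by
  have h := trace_permOp_swap₁₂_mul (Commute.one_right (permOp n (Equiv.swap (0 : Fin 3) 2)))
  rwa [Matrix.mul_one, Matrix.mul_one, trace_permOp_swap₀₁] at h

theorem trace_permOp_swap₀₂ : (permOp n (Equiv.swap (0 : Fin 3) 2)).trace =
    (Fintype.card n : ℂ) ^ 2 := by
  have h := trace_permOp_swap₀₂_mul (Commute.one_right (permOp n (Equiv.swap (1 : Fin 3) 2)))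
  rwa [Matrix.mul_one, Matrix.mul_one, trace_permOp_swap₀₁] at h

theorem trace_permOp_finRotate_inv : (permOp n (finRotate 3)⁻¹).trace = (Fintype.card n : ℂ) := by
  have h := trace_permOp_finRotate_inv_mul (Commute.one_right (permOp n (Equiv.swap (0 : Fin 3) 1)))
  rwa [Matrix.mul_one, Matrix.mul_one, trace_permOp_finRotate] at h

theorem trace_classOp (x y z : ℂ) : (classOp n x y z).trace =
    x * (Fintype.card n : ℂ) ^ 3 + 3 * y * (Fintype.card n : ℂ) ^ 2
      + 2 * z * (Fintype.card n : ℂ) := by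
  simp only [classOp, trace_add, trace_smul, smul_eq_mul, trace_permOp_one, trace_permOp_swap₀₁,
    trace_permOp_swap₁₂, trace_permOp_swap₀₂, trace_permOp_finRotate, trace_permOp_finRotate_inv]
  ring

theorem trace_swap₀₁_mul_classOp (x y z : ℂ) :
    (permOp n (Equiv.swap 0 1) * classOp n x y z).trace =
      x * (Fintype.card n : ℂ) ^ 2
        + y * ((Fintype.card n : ℂ) ^ 3 + 2 * (Fintype.card n : ℂ))
        + 2 * z * (Fintype.card n : ℂ) ^ 2 := by
  have h₀ : Equiv.swap 0 1 * Equiv.swap (0 : Fin 3) 1 = 1 := by decide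
  have h₁ : Equiv.swap 0 1 * Equiv.swap (1 : Fin 3) 2 = finRotate 3 := by decide
  have h₂ : Equiv.swap 0 1 * Equiv.swap (0 : Fin 3) 2 = (finRotate 3)⁻¹ := by decide
  have h₃ : Equiv.swap 0 1 * finRotate 3 = Equiv.swap (1 : Fin 3) 2 := by decide
  have h₄ : Equiv.swap 0 1 * (finRotate 3)⁻¹ = Equiv.swap (0 : Fin 3) 2 := by decide
  simp only [classOp, Matrix.mul_add, Matrix.mul_smul, permOp_mul, mul_one, h₀, h₁, h₂, h₃, h₄,
    trace_add, trace_smul, smul_eq_mul, trace_permOp_one, trace_permOp_swap₀₁,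
    trace_permOp_swap₁₂, trace_permOp_swap₀₂, trace_permOp_finRotate, trace_permOp_finRotate_inv]
  ring

theorem trace_finRotate_mul_classOp (x y z : ℂ) :
    (permOp n (finRotate 3) * classOp n x y z).trace =
      x * (Fintype.card n : ℂ) + 3 * y * (Fintype.card n : ℂ) ^ 2
        + z * ((Fintype.card n : ℂ) ^ 3 + (Fintype.card n : ℂ)) := by
  have h₀ : finRotate 3 * Equiv.swap (0 : Fin 3) 1 = Equiv.swap (0 : Fin 3) 2 := by decide
  have h₁ : finRotate 3 * Equiv.swap (1 : Fin 3) 2 = Equiv.swap (0 : Fin 3) 1 := by decide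
  have h₂ : finRotate 3 * Equiv.swap (0 : Fin 3) 2 = Equiv.swap (1 : Fin 3) 2 := by decide
  have h₃ : finRotate 3 * finRotate 3 = (finRotate 3)⁻¹ := by decide
  simp only [classOp, Matrix.mul_add, Matrix.mul_smul, permOp_mul, mul_one, h₀, h₁, h₂, h₃,
    mul_inv_cancel,
    trace_add, trace_smul, smul_eq_mul, trace_permOp_one, trace_permOp_swap₀₁,
    trace_permOp_swap₁₂, trace_permOp_swap₀₂, trace_permOp_finRotate, trace_permOp_finRotate_inv]
  ring

/-- The permutation operators are separated by their traces against each other. -/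
theorem classOp_eq_zero {x y z : ℂ} (h₁ : (classOp n x y z).trace = 0)
    (h₂ : (permOp n (Equiv.swap 0 1) * classOp n x y z).trace = 0)
    (h₃ : (permOp n (finRotate 3) * classOp n x y z).trace = 0) : classOp n x y z = 0 := by
  rw [← trace_conjTranspose_mul_self_eq_zero_iff]
  have k₁ := commute_permOp_swap₀₁_classOp (n := n) x y z
  have k₂ := commute_permOp_swap₁₂_classOp (n := n) x y z
  have k₃ : Commute (permOp n (Equiv.swap 0 2)) (classOp n x y z) := by
    have e : Equiv.swap 0 2 = Equiv.swap 0 1 * Equiv.swap 1 2 * Equiv.swap (0 : Fin 3) 1 := by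
      decide
    rw [e, ← permOp_mul, ← permOp_mul]
    exact (k₁.mul_left k₂).mul_left k₁
  have e₁ := trace_permOp_swap₁₂_mul k₃
  have e₂ := trace_permOp_swap₀₂_mul k₂
  have e₃ := trace_permOp_finRotate_inv_mul k₁
  have hadj : (classOp n x y z)ᴴ = classOp n (star x) (star y) (star z) := by
    simp only [classOp, conjTranspose_add, conjTranspose_smul, permOp_conjTranspose,
      Equiv.swap_inv, inv_inv, inv_one]
    rw [add_comm (permOp n (finRotate 3)⁻¹)]
  have hexp : (classOp n x y z)ᴴ * classOp n x y z =
      star x • classOp n x y z + star y • (permOp n (Equiv.swap 0 1) * classOp n x y z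
        + permOp n (Equiv.swap 1 2) * classOp n x y z + permOp n (Equiv.swap 0 2) * classOp n x y z)
      + star z • (permOp n (finRotate 3) * classOp n x y z
        + permOp n (finRotate 3)⁻¹ * classOp n x y z) := by
    rw [hadj]
    conv_lhs => rw [classOp]
    simp only [Matrix.add_mul, Matrix.smul_mul, permOp_one, Matrix.one_mul]
  -- The squared Hilbert-Schmidt norm is a combination of the six traces against permutations, and
  -- the three hypotheses cover their conjugacy classes.
  rw [hexp]
  simp [trace_add, trace_smul, e₁, e₂, e₃, h₁, h₂, h₃]

end ClassTrace

/-! ### The observable and its Haar twirl -/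

section Observable

variable {d : ℕ}

theorem wt_eq (a : Fin 3 → Fin d) : wt a =
    if a 0 = a 1 ∧ a 1 = a 2 then 3 else if a 0 = a 1 ∨ a 1 = a 2 ∨ a 0 = a 2 then 2 else 1 := by
  have hu : (Finset.univ : Finset (Fin 3)) = {0, 1, 2} := by decide
  have hsup (f : Fin 3 → ℕ) : Finset.univ.sup f = max (f 0) (max (f 1) (f 2)) := by
    rw [hu]; simp
  simp only [wt, hsup, Finset.card_filter, Fin.sum_univ_three, eq_comm (a := a 1) (b := a 0),
    eq_comm (a := a 2)]
  by_cases h₁ : a 0 = a 1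
  · by_cases h₂ : a 1 = a 2
    · simp [h₁, h₂]
    · simp [h₁, h₂]
  · by_cases h₂ : a 1 = a 2
    · simp [h₁, ← h₂]
    · have h₄ : ¬a 2 = a 1 := fun h => h₂ h.symm
      by_cases h₃ : a 0 = a 2
      · simp [h₂, h₃, h₄]
      · simp [h₁, h₂, h₃]

/-- The diagonal values are 4, (1-d)² and (1+d²)² for weights 1, 2 and 3; the coefficients are their
Möbius inversion. -/
theorem OPlus_sq_apply (a : Fin 3 → Fin d) : (OPlus d ^ 2) a a =
    4 + ((1 - (d : ℂ)) ^ 2 - 4) * ((if a 0 = a 1 then 1 else 0) + (if a 1 = a 2 then 1 else 0)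
        + (if a 0 = a 2 then 1 else 0))
      + ((1 + (d : ℂ) ^ 2) ^ 2 - 3 * (1 - (d : ℂ)) ^ 2 + 8)
        * (if a 0 = a 1 ∧ a 1 = a 2 then 1 else 0) := by
  rw [OPlus, diagonal_pow, diagonal_apply_eq, Pi.pow_apply, wt_eq]
  by_cases h₁ : a 0 = a 1
  · by_cases h₂ : a 1 = a 2
    · simp [h₁, h₂]; ring
    · simp [h₁, h₂]; ring
  · by_cases h₂ : a 1 = a 2
    · simp [h₁, ← h₂]; ring
    · have h₄ : ¬a 2 = a 1 := fun h => h₂ h.symm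
      by_cases h₃ : a 0 = a 2
      · simp [h₂, h₃, h₄]; ring
      · simp [h₁, h₂, h₃]; norm_num

theorem commute_permOp_OPlus_sq (σ : Equiv.Perm (Fin 3)) :
    Commute (permOp (Fin d) σ) (OPlus d ^ 2) := by
  refine Commute.pow_right ((commute_permOp_iff σ _).2 fun a b => ?_) 2
  have hwt : wt (a ∘ σ) = wt a := by
    have hcard (i : Fin 3) : (Finset.univ.filter fun j => (a ∘ σ) j = (a ∘ σ) i).card =
        (Finset.univ.filter fun j => a j = a (σ i)).card := by
      simp only [Finset.card_filter, Function.comp_apply]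
      exact Equiv.sum_comp σ fun j => if a j = a (σ i) then 1 else 0
    simp only [wt, hcard]
    have hmap := Finset.sup_map Finset.univ σ.toEmbedding
      fun i => (Finset.univ.filter fun j => a j = a i).card
    rw [Finset.map_univ_equiv] at hmap
    exact hmap.symm
  have hab : a ∘ σ = b ∘ σ ↔ a = b := σ.surjective.injective_comp_right.eq_iff
  simp [OPlus, diagonal_apply, hab, hwt]

theorem trace_permOp_mul_OPlus_sq (σ : Equiv.Perm (Fin 3)) :
    (permOp (Fin d) σ * OPlus d ^ 2).trace =
      ∑ a, permOp (Fin d) σ a a * (OPlus d ^ 2) a a := by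
  rw [OPlus, diagonal_pow]
  simp [trace, mul_diagonal]

theorem trace_diagonal_expansion (c c' e : ℂ) :
    ∑ a : Fin 3 → Fin d, (c + c' * ((if a 0 = a 1 then 1 else 0) + (if a 1 = a 2 then 1 else 0)
        + (if a 0 = a 2 then 1 else 0)) + e * (if a 0 = a 1 ∧ a 1 = a 2 then 1 else 0)) =
      c * (d : ℂ) ^ 3 + 3 * c' * d ^ 2 + e * d := by
  -- The sum is the trace of a class operator with this diagonal, `e` being split between the two
  -- 3-cycles.
  have h := trace_classOp (n := Fin d) c c' (e / 2)
  rw [Fintype.card_fin] at h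
  rw [show c * (d : ℂ) ^ 3 + 3 * c' * d ^ 2 + e * d = c * (d : ℂ) ^ 3 + 3 * c' * d ^ 2
    + 2 * (e / 2) * d by ring, ← h]
  refine Finset.sum_congr rfl fun a _ => ?_
  simp only [classOp, diag_apply, Matrix.add_apply, Matrix.smul_apply, smul_eq_mul,
    permOp_swap₀₁_diag, permOp_swap₁₂_diag, permOp_swap₀₂_diag, permOp_finRotate_diag,
    permOp_finRotate_inv_diag, permOp_one_diag]
  ring

theorem trace_OPlus_sq : (OPlus d ^ 2).trace =
    4 * (d : ℂ) ^ 3 + 3 * ((1 - (d : ℂ)) ^ 2 - 4) * d ^ 2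
      + ((1 + (d : ℂ) ^ 2) ^ 2 - 3 * (1 - (d : ℂ)) ^ 2 + 8) * d := by
  rw [← trace_diagonal_expansion]
  exact Finset.sum_congr rfl fun a _ => OPlus_sq_apply a

theorem trace_swap₀₁_mul_OPlus_sq : (permOp (Fin d) (Equiv.swap 0 1) * OPlus d ^ 2).trace =
    (1 - (d : ℂ)) ^ 2 * d ^ 2 + ((1 + (d : ℂ) ^ 2) ^ 2 - (1 - (d : ℂ)) ^ 2) * d := by
  have h : (permOp (Fin d) (Equiv.swap 0 1) * OPlus d ^ 2).trace =
      (1 - (d : ℂ)) ^ 2 * (permOp (Fin d) (Equiv.swap (0 : Fin 3) 1)).trace +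
        ((1 + (d : ℂ) ^ 2) ^ 2 - (1 - (d : ℂ)) ^ 2) * (permOp (Fin d) (finRotate 3)).trace := by
    rw [trace_permOp_mul_OPlus_sq, trace, trace, Finset.mul_sum, Finset.mul_sum,
      ← Finset.sum_add_distrib]
    refine Finset.sum_congr rfl fun a _ => ?_
    rw [OPlus_sq_apply, diag_apply, diag_apply, permOp_swap₀₁_diag, permOp_finRotate_diag]
    by_cases h₁ : a 0 = a 1
    · by_cases h₂ : a 1 = a 2
      · simp [h₁, h₂]; ring
      · simp [h₁, h₂]
    · simp [h₁]
  rw [h, trace_permOp_swap₀₁, trace_permOp_finRotate, Fintype.card_fin]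

theorem trace_finRotate_mul_OPlus_sq : (permOp (Fin d) (finRotate 3) * OPlus d ^ 2).trace =
    (1 + (d : ℂ) ^ 2) ^ 2 * d := by
  have h : (permOp (Fin d) (finRotate 3) * OPlus d ^ 2).trace =
      (1 + (d : ℂ) ^ 2) ^ 2 * (permOp (Fin d) (finRotate 3)).trace := by
    rw [trace_permOp_mul_OPlus_sq, trace, Finset.mul_sum]
    refine Finset.sum_congr rfl fun a _ => ?_
    rw [OPlus_sq_apply, diag_apply, permOp_finRotate_diag]
    by_cases h : a 0 = a 1 ∧ a 1 = a 2
    · simp [h.1, h.2]; ring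
    · simp [h]
  rw [h, trace_permOp_finRotate, Fintype.card_fin]

/-- The Haar twirl of `O₊²`. -/
theorem twirl_OPlus_sq : twirl 3 (haarU d) (OPlus d ^ 2) =
    classOp (Fin d) (((d : ℂ) - 1) * (d ^ 2 + 3 * d + 4) / (d + 2))
      (d * ((d : ℂ) ^ 2 - 1) / (d + 2)) ((6 + ((d : ℂ) - 1) * d ^ 2) / (d + 2)) := by
  have hcomm (σ : Equiv.Perm (Fin 3)) := commute_permOp_twirl (commute_permOp_OPlus_sq (d := d) σ)
  obtain ⟨x, y, z, h⟩ := exists_eq_classOp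
    (fun W => commute_tensorPow_twirl W (OPlus d ^ 2)) (hcomm _) (hcomm _)
  have hd : (d : ℂ) + 2 ≠ 0 := by exact_mod_cast (Nat.succ_ne_zero (d + 1))
  have htr (σ : Equiv.Perm (Fin 3)) : (permOp (Fin d) σ * classOp (Fin d) x y z).trace =
      (permOp (Fin d) σ * OPlus d ^ 2).trace := by
    rw [← h, trace_mul_comm, trace_twirl_mul_permOp, trace_mul_comm]
  have h₁ := htr 1
  have h₂ := htr (Equiv.swap 0 1)
  have h₃ := htr (finRotate 3)
  rw [permOp_one, Matrix.one_mul, Matrix.one_mul, trace_classOp, trace_OPlus_sq,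
    Fintype.card_fin] at h₁
  rw [trace_swap₀₁_mul_classOp, trace_swap₀₁_mul_OPlus_sq, Fintype.card_fin] at h₂
  rw [trace_finRotate_mul_classOp, trace_finRotate_mul_OPlus_sq, Fintype.card_fin] at h₃
  rw [h, ← sub_eq_zero, classOp_sub]
  -- Only the difference from the claimed operator is shown to vanish; x, y, z themselves stay
  -- undetermined.
  apply classOp_eq_zero
  · rw [trace_classOp, Fintype.card_fin]
    field_simp
    linear_combination ((d : ℂ) + 2) * h₁
  · rw [trace_swap₀₁_mul_classOp, Fintype.card_fin]
    field_simp
    linear_combination ((d : ℂ) + 2) * h₂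
  · rw [trace_finRotate_mul_classOp, Fintype.card_fin]
    field_simp
    linear_combination ((d : ℂ) + 2) * h₃

end Observable

end BilocalTwirl

namespace BilocalTwirl

/-! ### Contractions of three copies of a bipartite operator -/

section Bilocal

variable {d : ℕ}

/-- The contraction `Tr[(P_σ ⊗ P_τ) ρ^{⊗3}]` of three copies of a bipartite operator. -/
def permContraction (ρ : Matrix (Fin d × Fin d) (Fin d × Fin d) ℂ)
    (σ τ : Equiv.Perm (Fin 3)) : ℂ :=
  ∑ s : Fin 3 → Fin d × Fin d, ∏ i, ρ ((s (σ i)).1, (s (τ i)).2) (s i)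

/-- The expectation value of `X ⊗ Y` on `ρ^{⊗3}`. -/
def bilocalTrace (ρ : Matrix (Fin d × Fin d) (Fin d × Fin d) ℂ)
    (X Y : Matrix (Fin 3 → Fin d) (Fin 3 → Fin d) ℂ) : ℂ :=
  (regroup (X ⊗ₖ Y) * tensorPow 3 ρ).trace

variable (ρ : Matrix (Fin d × Fin d) (Fin d × Fin d) ℂ)

theorem bilocalTrace_eq_sum (X Y : Matrix (Fin 3 → Fin d) (Fin 3 → Fin d) ℂ) :
    bilocalTrace ρ X Y = ∑ s : Fin 3 → Fin d × Fin d, ∑ t : Fin 3 → Fin d × Fin d,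
      X (fun i => (s i).1) (fun i => (t i).1) * Y (fun i => (s i).2) (fun i => (t i).2)
        * ∏ i, ρ (t i) (s i) := by
  simp [bilocalTrace, trace, mul_apply, regroup, tensorPow]

theorem bilocalTrace_add_left (X X' Y : Matrix (Fin 3 → Fin d) (Fin 3 → Fin d) ℂ) :
    bilocalTrace ρ (X + X') Y = bilocalTrace ρ X Y + bilocalTrace ρ X' Y := by
  simp only [bilocalTrace_eq_sum, Matrix.add_apply, add_mul, Finset.sum_add_distrib]

theorem bilocalTrace_add_right (X Y Y' : Matrix (Fin 3 → Fin d) (Fin 3 → Fin d) ℂ) :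
    bilocalTrace ρ X (Y + Y') = bilocalTrace ρ X Y + bilocalTrace ρ X Y' := by
  simp only [bilocalTrace_eq_sum, Matrix.add_apply, add_mul, mul_add, Finset.sum_add_distrib]

theorem bilocalTrace_smul_left (c : ℂ) (X Y : Matrix (Fin 3 → Fin d) (Fin 3 → Fin d) ℂ) :
    bilocalTrace ρ (c • X) Y = c * bilocalTrace ρ X Y := by
  simp only [bilocalTrace_eq_sum, Matrix.smul_apply, smul_eq_mul, Finset.mul_sum, mul_assoc]

theorem bilocalTrace_smul_right (c : ℂ) (X Y : Matrix (Fin 3 → Fin d) (Fin 3 → Fin d) ℂ) :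
    bilocalTrace ρ X (c • Y) = c * bilocalTrace ρ X Y := by
  simp only [bilocalTrace_eq_sum, Matrix.smul_apply, smul_eq_mul, Finset.mul_sum]
  exact Finset.sum_congr rfl fun s _ => Finset.sum_congr rfl fun t _ => by ring

theorem bilocalTrace_permOp (σ τ : Equiv.Perm (Fin 3)) :
    bilocalTrace ρ (permOp (Fin d) σ) (permOp (Fin d) τ) = permContraction ρ σ τ := by
  rw [bilocalTrace_eq_sum, permContraction]
  refine Finset.sum_congr rfl fun s _ => ?_
  rw [Finset.sum_eq_single fun i => ((s (σ i)).1, (s (τ i)).2)]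
  · simp [permOp, Function.comp_def]
  · intro t _ ht
    have h : ¬((fun i => (s i).1) ∘ σ = (fun i => (t i).1) ∧
        (fun i => (s i).2) ∘ τ = fun i => (t i).2) := fun h =>
      ht (funext fun i => Prod.ext (congrFun h.1 i).symm (congrFun h.2 i).symm)
    rcases not_and_or.1 h with h | h <;> simp [permOp, h]
  · simp

/-- All copies carry the same ρ, so relabelling them by π leaves the sum unchanged. -/
theorem permContraction_conj {σ τ σ' τ' : Equiv.Perm (Fin 3)} (π : Equiv.Perm (Fin 3))
    (hσ : π * σ = σ' * π) (hτ : π * τ = τ' * π) :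
    permContraction ρ σ' τ' = permContraction ρ σ τ := by
  rw [permContraction, permContraction, ← Equiv.sum_comp
    (Equiv.arrowCongr π (Equiv.refl (Fin d × Fin d)))]
  refine Finset.sum_congr rfl fun s _ => ?_
  rw [← Equiv.prod_comp π]
  refine Finset.prod_congr rfl fun i _ => ?_
  have h₁ : π.symm (σ' (π i)) = σ i := by
    rw [Equiv.symm_apply_eq]; exact (DFunLike.congr_fun hσ i).symm
  have h₂ : π.symm (τ' (π i)) = τ i := by
    rw [Equiv.symm_apply_eq]; exact (DFunLike.congr_fun hτ i).symm
  simp [Equiv.arrowCongr, h₁, h₂]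

theorem permContraction_eq_sum (σ τ : Equiv.Perm (Fin 3)) :
    permContraction ρ σ τ = ∑ a₀, ∑ b₀, ∑ a₁, ∑ b₁, ∑ a₂, ∑ b₂,
      ρ (![a₀, a₁, a₂] (σ 0), ![b₀, b₁, b₂] (τ 0)) (a₀, b₀)
        * ρ (![a₀, a₁, a₂] (σ 1), ![b₀, b₁, b₂] (τ 1)) (a₁, b₁)
        * ρ (![a₀, a₁, a₂] (σ 2), ![b₀, b₁, b₂] (τ 2)) (a₂, b₂) := by
  have h := sum_fin_three_arrow fun x y z : Fin d × Fin d =>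
    ρ (![x.1, y.1, z.1] (σ 0), ![x.2, y.2, z.2] (τ 0)) x
        * ρ (![x.1, y.1, z.1] (σ 1), ![x.2, y.2, z.2] (τ 1)) y
        * ρ (![x.1, y.1, z.1] (σ 2), ![x.2, y.2, z.2] (τ 2)) z
  simp only [Fintype.sum_prod_type] at h
  rw [← h, permContraction]
  refine Finset.sum_congr rfl fun s _ => ?_
  have h₁ (i : Fin 3) : ![(s 0).1, (s 1).1, (s 2).1] i = (s i).1 := by fin_cases i <;> rfl
  have h₂ (i : Fin 3) : ![(s 0).2, (s 1).2, (s 2).2] i = (s i).2 := by fin_cases i <;> rfl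
  simp only [Fin.prod_univ_three, h₁, h₂]

theorem sum_six_eq {n : Type*} [Fintype n] (F : n → n → n → n → n → n → ℂ) :
    ∑ a, ∑ b, ∑ c, ∑ e, ∑ f, ∑ g, F a b c e f g =
      ∑ v : Fin 6 → n, F (v 0) (v 1) (v 2) (v 3) (v 4) (v 5) := by
  let e : (n × n × n × n × n × n) ≃ (Fin 6 → n) :=
    { toFun := fun p => ![p.1, p.2.1, p.2.2.1, p.2.2.2.1, p.2.2.2.2.1, p.2.2.2.2.2]
      invFun := fun a => (a 0, a 1, a 2, a 3, a 4, a 5)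
      left_inv := fun _ => rfl
      right_inv := fun a => by ext i; fin_cases i <;> rfl }
  rw [← Equiv.sum_comp e]
  simp only [Fintype.sum_prod_type]
  rfl

/-- Each contraction identity is a renaming of six summation indices: `p` lists, for each index on
the right, the index on the left that plays its role. -/
theorem sum_six_reorder {n : Type*} [Fintype n] {F G : n → n → n → n → n → n → ℂ}
    (p : Fin 6 → Fin 6) (hp : Function.Bijective p)
    (h : ∀ v : Fin 6 → n, F (v 0) (v 1) (v 2) (v 3) (v 4) (v 5) =
      G (v (p 0)) (v (p 1)) (v (p 2)) (v (p 3)) (v (p 4)) (v (p 5))) :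
    ∑ a, ∑ b, ∑ c, ∑ e, ∑ f, ∑ g, F a b c e f g =
      ∑ a, ∑ b, ∑ c, ∑ e, ∑ f, ∑ g, G a b c e f g := by
  rw [sum_six_eq, sum_six_eq, ← Equiv.sum_comp
    (Equiv.arrowCongr (Equiv.ofBijective p hp).symm (Equiv.refl n))
    fun v : Fin 6 → n => G (v 0) (v 1) (v 2) (v 3) (v 4) (v 5)]
  exact Finset.sum_congr rfl fun v _ => h v

theorem trace_mul_one_kronecker (M : Matrix (Fin d × Fin d) (Fin d × Fin d) ℂ)
    (Y : Matrix (Fin d) (Fin d) ℂ) :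
    (M * ((1 : Matrix (Fin d) (Fin d) ℂ) ⊗ₖ Y)).trace =
      ∑ x, ∑ y, ∑ z, M (x, y) (x, z) * Y z y := by
  simp only [trace, diag_apply, mul_apply, Fintype.sum_prod_type, kroneckerMap_apply]
  refine Finset.sum_congr rfl fun x _ => Finset.sum_congr rfl fun y _ => ?_
  rw [Finset.sum_eq_single x]
  · simp
  · intro b _ hb
    simp [one_apply_ne hb]
  · simp

theorem trace_mul_kronecker_one (M : Matrix (Fin d × Fin d) (Fin d × Fin d) ℂ)
    (Y : Matrix (Fin d) (Fin d) ℂ) :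
    (M * (Y ⊗ₖ (1 : Matrix (Fin d) (Fin d) ℂ))).trace =
      ∑ x, ∑ y, ∑ z, M (x, y) (z, y) * Y z x := by
  simp only [trace, diag_apply, mul_apply, Fintype.sum_prod_type, kroneckerMap_apply]
  refine Finset.sum_congr rfl fun x _ => Finset.sum_congr rfl fun y _ =>
    Finset.sum_congr rfl fun z _ => ?_
  rw [Finset.sum_eq_single y]
  · simp
  · intro b _ hb
    simp [one_apply_ne hb]
  · simp

theorem swap₀₁_apply_two : Equiv.swap (0 : Fin 3) 1 2 = 2 := rfl

theorem swap₁₂_apply_zero : Equiv.swap (1 : Fin 3) 2 0 = 0 := rfl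

theorem finRotate_three_apply_zero : finRotate 3 0 = 1 := rfl

theorem finRotate_three_apply_one : finRotate 3 1 = 2 := rfl

theorem finRotate_three_apply_two : finRotate 3 2 = 0 := rfl

theorem finRotate_three_inv_apply_zero : (finRotate 3)⁻¹ 0 = 2 := rfl

theorem finRotate_three_inv_apply_one : (finRotate 3)⁻¹ 1 = 0 := rfl

theorem finRotate_three_inv_apply_two : (finRotate 3)⁻¹ 2 = 1 := rfl

theorem permContraction_one_one :
    permContraction ρ 1 1 = ρ.trace ^ 3 := by
  simp only [permContraction_eq_sum, trace, pow_succ, pow_zero, one_mul, diag_apply, Fintype.sum_prod_type,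
    Finset.sum_mul, Finset.mul_sum, Equiv.Perm.one_apply]
  refine sum_six_reorder ![0, 1, 2, 3, 4, 5] (by decide) fun v => ?_
  simp only [cons_val]
  ring

theorem permContraction_one_swap :
    permContraction ρ 1 (Equiv.swap 0 1) = (redB ρ ^ 2).trace * ρ.trace := by
  simp only [permContraction_eq_sum, trace, sq, diag_apply, mul_apply, redB, of_apply, Fintype.sum_prod_type,
    Finset.sum_mul, Finset.mul_sum, Equiv.Perm.one_apply, Equiv.swap_apply_left, Equiv.swap_apply_right, swap₀₁_apply_two]
  refine sum_six_reorder ![4, 5, 1, 3, 0, 2] (by decide) fun v => ?_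
  simp only [cons_val]
  ring

theorem permContraction_swap_one :
    permContraction ρ (Equiv.swap 0 1) 1 = (redA ρ ^ 2).trace * ρ.trace := by
  simp only [permContraction_eq_sum, trace, sq, diag_apply, mul_apply, redA, of_apply, Fintype.sum_prod_type,
    Finset.sum_mul, Finset.mul_sum, Equiv.swap_apply_left, Equiv.swap_apply_right, swap₀₁_apply_two, Equiv.Perm.one_apply]
  refine sum_six_reorder ![4, 5, 0, 2, 1, 3] (by decide) fun v => ?_
  simp only [cons_val]
  ring

theorem permContraction_one_finRotate :
    permContraction ρ 1 (finRotate 3) = (redB ρ ^ 3).trace := by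
  simp only [permContraction_eq_sum, trace, pow_succ, pow_zero, one_mul, diag_apply, mul_apply, redB, of_apply,
    Finset.sum_mul, Finset.mul_sum, Equiv.Perm.one_apply, finRotate_three_apply_zero, finRotate_three_apply_one, finRotate_three_apply_two]
  refine sum_six_reorder ![1, 3, 0, 5, 2, 4] (by decide) fun v => ?_
  simp only [cons_val]
  ring

theorem permContraction_finRotate_one :
    permContraction ρ (finRotate 3) 1 = (redA ρ ^ 3).trace := by
  simp only [permContraction_eq_sum, trace, pow_succ, pow_zero, one_mul, diag_apply, mul_apply, redA, of_apply,
    Finset.sum_mul, Finset.mul_sum, finRotate_three_apply_zero, finRotate_three_apply_one, finRotate_three_apply_two, Equiv.Perm.one_apply]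
  refine sum_six_reorder ![0, 2, 1, 4, 3, 5] (by decide) fun v => ?_
  simp only [cons_val]
  ring

theorem permContraction_swap_swap :
    permContraction ρ (Equiv.swap 0 1) (Equiv.swap 0 1) = (ρ ^ 2).trace * ρ.trace := by
  simp only [permContraction_eq_sum, trace, sq, diag_apply, mul_apply, Fintype.sum_prod_type,
    Finset.sum_mul, Finset.mul_sum, Equiv.swap_apply_left, Equiv.swap_apply_right, swap₀₁_apply_two]
  refine sum_six_reorder ![4, 5, 0, 1, 2, 3] (by decide) fun v => ?_
  simp only [cons_val]
  ring

/-- Copy 1 meets copy 0 on A and copy 2 on B; the idle sides of copies 0 and 2 are traced out. -/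
theorem permContraction_swap₀₁_swap₁₂ :
    permContraction ρ (Equiv.swap 0 1) (Equiv.swap 1 2) = (ρ * (redA ρ ⊗ₖ redB ρ)).trace := by
  simp only [permContraction_eq_sum, trace, diag_apply, mul_apply, redA, redB, of_apply, kroneckerMap_apply, Fintype.sum_prod_type,
    Finset.sum_mul, Finset.mul_sum, Equiv.swap_apply_left, Equiv.swap_apply_right, swap₀₁_apply_two, swap₁₂_apply_zero]
  refine sum_six_reorder ![0, 5, 2, 3, 4, 1] (by decide) fun v => ?_
  simp only [cons_val]
  ring

theorem permContraction_swap_finRotate :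
    permContraction ρ (Equiv.swap 0 1) (finRotate 3) = (ρ ^ 2 * ((1 : Matrix (Fin d) (Fin d) ℂ) ⊗ₖ redB ρ)).trace := by
  simp only [permContraction_eq_sum, trace_mul_one_kronecker, sq, mul_apply, redB, of_apply, Fintype.sum_prod_type,
    Finset.sum_mul, Finset.mul_sum, Equiv.swap_apply_left, Equiv.swap_apply_right, swap₀₁_apply_two, finRotate_three_apply_zero, finRotate_three_apply_one, finRotate_three_apply_two]
  refine sum_six_reorder ![0, 5, 1, 4, 2, 3] (by decide) fun v => ?_
  simp only [cons_val]
  ring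

theorem permContraction_finRotate_swap :
    permContraction ρ (finRotate 3) (Equiv.swap 0 1) = (ρ ^ 2 * (redA ρ ⊗ₖ (1 : Matrix (Fin d) (Fin d) ℂ))).trace := by
  simp only [permContraction_eq_sum, trace_mul_kronecker_one, sq, mul_apply, redA, of_apply, Fintype.sum_prod_type,
    Finset.sum_mul, Finset.mul_sum, finRotate_three_apply_zero, finRotate_three_apply_one, finRotate_three_apply_two, Equiv.swap_apply_left, Equiv.swap_apply_right, swap₀₁_apply_two]
  refine sum_six_reorder ![4, 1, 0, 5, 2, 3] (by decide) fun v => ?_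
  simp only [cons_val]
  ring

theorem permContraction_finRotate_finRotate :
    permContraction ρ (finRotate 3) (finRotate 3) = (ρ ^ 3).trace := by
  simp only [permContraction_eq_sum, trace, pow_succ, pow_zero, one_mul, diag_apply, mul_apply, Fintype.sum_prod_type,
    Finset.sum_mul, finRotate_three_apply_zero, finRotate_three_apply_one, finRotate_three_apply_two]
  refine sum_six_reorder ![0, 1, 2, 3, 4, 5] (by decide) fun v => ?_
  simp only [cons_val]
  ring

/-- Transposing A reverses the cycle on that side, so both sides then run in the same sense. -/
theorem permContraction_finRotate_finRotate_inv :
    permContraction ρ (finRotate 3) (finRotate 3)⁻¹ = (ptA ρ ^ 3).trace := by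
  simp only [permContraction_eq_sum, trace, pow_succ, pow_zero, one_mul, diag_apply, mul_apply, ptA, of_apply, Fintype.sum_prod_type,
    Finset.sum_mul, finRotate_three_apply_zero, finRotate_three_apply_one, finRotate_three_apply_two, finRotate_three_inv_apply_zero, finRotate_three_inv_apply_one, finRotate_three_inv_apply_two]
  refine sum_six_reorder ![0, 5, 4, 3, 2, 1] (by decide) fun v => ?_
  simp only [cons_val]

/-- The expectation value on `ρ^{⊗3}` of two class functions of the permutation operators. -/
theorem bilocalTrace_classOp (hρ : ρ.trace = 1) (x y z x' y' z' : ℂ) :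
    bilocalTrace ρ (classOp (Fin d) x y z) (classOp (Fin d) x' y' z') =
      x * x' + 3 * x * y' * (redB ρ ^ 2).trace + 3 * y * x' * (redA ρ ^ 2).trace
        + 2 * x * z' * (redB ρ ^ 3).trace + 2 * z * x' * (redA ρ ^ 3).trace
        + 3 * y * y' * (ρ ^ 2).trace + 6 * y * y' * (ρ * (redA ρ ⊗ₖ redB ρ)).trace
        + 6 * y * z' * (ρ ^ 2 * ((1 : Matrix (Fin d) (Fin d) ℂ) ⊗ₖ redB ρ)).trace
        + 6 * z * y' * (ρ ^ 2 * (redA ρ ⊗ₖ (1 : Matrix (Fin d) (Fin d) ℂ))).trace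
        + 2 * z * z' * (ρ ^ 3).trace + 2 * z * z' * (ptA ρ ^ 3).trace := by
  simp only [classOp, bilocalTrace_add_left, bilocalTrace_add_right, bilocalTrace_smul_left,
    bilocalTrace_smul_right, bilocalTrace_permOp]
  -- Each of the 25 other pairs is moved to one of 11 class representatives; the class sizes 1, 2,
  -- 3, 6 become the numerical coefficients.
  rw [
    permContraction_conj ρ (σ := 1) (τ := (Equiv.swap 0 1)) (σ' := 1) (τ' := (Equiv.swap 1 2)) (finRotate 3)
      (by decide) (by decide),
    permContraction_conj ρ (σ := 1) (τ := (Equiv.swap 0 1)) (σ' := 1) (τ' := (Equiv.swap 0 2)) (Equiv.swap 1 2)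
      (by decide) (by decide),
    permContraction_conj ρ (σ := 1) (τ := (finRotate 3)) (σ' := 1) (τ' := (finRotate 3)⁻¹) (Equiv.swap 1 2)
      (by decide) (by decide),
    permContraction_conj ρ (σ := (Equiv.swap 0 1)) (τ := (Equiv.swap 1 2)) (σ' := (Equiv.swap 0 1)) (τ' := (Equiv.swap 0 2)) (Equiv.swap 0 1)
      (by decide) (by decide),
    permContraction_conj ρ (σ := (Equiv.swap 0 1)) (τ := (finRotate 3)) (σ' := (Equiv.swap 0 1)) (τ' := (finRotate 3)⁻¹) (Equiv.swap 0 1)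
      (by decide) (by decide),
    permContraction_conj ρ (σ := (Equiv.swap 0 1)) (τ := 1) (σ' := (Equiv.swap 1 2)) (τ' := 1) (finRotate 3)
      (by decide) (by decide),
    permContraction_conj ρ (σ := (Equiv.swap 0 1)) (τ := (Equiv.swap 1 2)) (σ' := (Equiv.swap 1 2)) (τ' := (Equiv.swap 0 1)) (Equiv.swap 0 2)
      (by decide) (by decide),
    permContraction_conj ρ (σ := (Equiv.swap 0 1)) (τ := (Equiv.swap 0 1)) (σ' := (Equiv.swap 1 2)) (τ' := (Equiv.swap 1 2)) (finRotate 3)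
      (by decide) (by decide),
    permContraction_conj ρ (σ := (Equiv.swap 0 1)) (τ := (Equiv.swap 1 2)) (σ' := (Equiv.swap 1 2)) (τ' := (Equiv.swap 0 2)) (finRotate 3)
      (by decide) (by decide),
    permContraction_conj ρ (σ := (Equiv.swap 0 1)) (τ := (finRotate 3)) (σ' := (Equiv.swap 1 2)) (τ' := (finRotate 3)) (finRotate 3)
      (by decide) (by decide),
    permContraction_conj ρ (σ := (Equiv.swap 0 1)) (τ := (finRotate 3)) (σ' := (Equiv.swap 1 2)) (τ' := (finRotate 3)⁻¹) (Equiv.swap 0 2)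
      (by decide) (by decide),
    permContraction_conj ρ (σ := (Equiv.swap 0 1)) (τ := 1) (σ' := (Equiv.swap 0 2)) (τ' := 1) (Equiv.swap 1 2)
      (by decide) (by decide),
    permContraction_conj ρ (σ := (Equiv.swap 0 1)) (τ := (Equiv.swap 1 2)) (σ' := (Equiv.swap 0 2)) (τ' := (Equiv.swap 0 1)) (finRotate 3)⁻¹
      (by decide) (by decide),
    permContraction_conj ρ (σ := (Equiv.swap 0 1)) (τ := (Equiv.swap 1 2)) (σ' := (Equiv.swap 0 2)) (τ' := (Equiv.swap 1 2)) (Equiv.swap 1 2)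
      (by decide) (by decide),
    permContraction_conj ρ (σ := (Equiv.swap 0 1)) (τ := (Equiv.swap 0 1)) (σ' := (Equiv.swap 0 2)) (τ' := (Equiv.swap 0 2)) (Equiv.swap 1 2)
      (by decide) (by decide),
    permContraction_conj ρ (σ := (Equiv.swap 0 1)) (τ := (finRotate 3)) (σ' := (Equiv.swap 0 2)) (τ' := (finRotate 3)) (finRotate 3)⁻¹
      (by decide) (by decide),
    permContraction_conj ρ (σ := (Equiv.swap 0 1)) (τ := (finRotate 3)) (σ' := (Equiv.swap 0 2)) (τ' := (finRotate 3)⁻¹) (Equiv.swap 1 2)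
      (by decide) (by decide),
    permContraction_conj ρ (σ := (finRotate 3)) (τ := (Equiv.swap 0 1)) (σ' := (finRotate 3)) (τ' := (Equiv.swap 1 2)) (finRotate 3)
      (by decide) (by decide),
    permContraction_conj ρ (σ := (finRotate 3)) (τ := (Equiv.swap 0 1)) (σ' := (finRotate 3)) (τ' := (Equiv.swap 0 2)) (finRotate 3)⁻¹
      (by decide) (by decide),
    permContraction_conj ρ (σ := (finRotate 3)) (τ := 1) (σ' := (finRotate 3)⁻¹) (τ' := 1) (Equiv.swap 1 2)
      (by decide) (by decide),
    permContraction_conj ρ (σ := (finRotate 3)) (τ := (Equiv.swap 0 1)) (σ' := (finRotate 3)⁻¹) (τ' := (Equiv.swap 0 1)) (Equiv.swap 0 1)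
      (by decide) (by decide),
    permContraction_conj ρ (σ := (finRotate 3)) (τ := (Equiv.swap 0 1)) (σ' := (finRotate 3)⁻¹) (τ' := (Equiv.swap 1 2)) (Equiv.swap 0 2)
      (by decide) (by decide),
    permContraction_conj ρ (σ := (finRotate 3)) (τ := (Equiv.swap 0 1)) (σ' := (finRotate 3)⁻¹) (τ' := (Equiv.swap 0 2)) (Equiv.swap 1 2)
      (by decide) (by decide),
    permContraction_conj ρ (σ := (finRotate 3)) (τ := (finRotate 3)⁻¹) (σ' := (finRotate 3)⁻¹) (τ' := (finRotate 3)) (Equiv.swap 1 2)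
      (by decide) (by decide),
    permContraction_conj ρ (σ := (finRotate 3)) (τ := (finRotate 3)) (σ' := (finRotate 3)⁻¹) (τ' := (finRotate 3)⁻¹) (Equiv.swap 1 2)
      (by decide) (by decide)]
  rw [permContraction_one_one, permContraction_one_swap, permContraction_swap_one,
    permContraction_one_finRotate, permContraction_finRotate_one, permContraction_swap_swap,
    permContraction_swap₀₁_swap₁₂, permContraction_swap_finRotate, permContraction_finRotate_swap,
    permContraction_finRotate_finRotate, permContraction_finRotate_finRotate_inv, hρ]
  ring

end Bilocal

end BilocalTwirl

theorem mainTheorem10 (d : ℕ)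
    (μA μB : MeasureTheory.Measure (BilocalTwirl.U d))
    (hA : BilocalTwirl.IsUnitaryDesign 3 μA) (hB : BilocalTwirl.IsUnitaryDesign 3 μB)
    (ρ : Matrix (Fin d × Fin d) (Fin d × Fin d) ℂ) (hρ : BilocalTwirl.IsState ρ) :
    (BilocalTwirl.regroup
        (BilocalTwirl.twirl 3 μA (BilocalTwirl.OPlus d ^ 2) ⊗ₖ
          BilocalTwirl.twirl 3 μB (BilocalTwirl.OPlus d ^ 2)) *
      BilocalTwirl.tensorPow 3 ρ).trace =
    1 / ((d : ℂ) + 2) ^ 2 *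
      (((BilocalTwirl.redA ρ ^ 2).trace + (BilocalTwirl.redB ρ ^ 2).trace) *
          (3 * d * (d - 1) ^ 2 * (d + 1) * (d ^ 2 + 3 * d + 4))
        + ((BilocalTwirl.redA ρ ^ 3).trace + (BilocalTwirl.redB ρ ^ 3).trace) *
          (2 * (d - 1) * (6 + (d - 1) * d ^ 2) * (d ^ 2 + 3 * d + 4))
        + (ρ ^ 2).trace * (3 * d ^ 2 * (d ^ 2 - 1) ^ 2)
        + (ρ ^ 3).trace * (2 * (6 + (d - 1) * d ^ 2) ^ 2)
        + (ρ * (BilocalTwirl.redA ρ ⊗ₖ BilocalTwirl.redB ρ)).trace *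
          (6 * d ^ 2 * (d ^ 2 - 1) ^ 2)
        + ((ρ ^ 2 * (BilocalTwirl.redA ρ ⊗ₖ (1 : Matrix (Fin d) (Fin d) ℂ))).trace
            + (ρ ^ 2 * ((1 : Matrix (Fin d) (Fin d) ℂ) ⊗ₖ BilocalTwirl.redB ρ)).trace) *
          (6 * d * (d - 1) * (d + 1) * ((d - 1) * d ^ 2 + 6))
        + 2 * (BilocalTwirl.ptA ρ ^ 3).trace * ((d - 1) * d ^ 2 + 6) ^ 2
        + (d * (d + 1) ^ 2 - 4) ^ 2) := by
  rw [hA.2, hB.2, BilocalTwirl.twirl_OPlus_sq]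
  have h := BilocalTwirl.bilocalTrace_classOp ρ hρ.2
    (((d : ℂ) - 1) * (d ^ 2 + 3 * d + 4) / (d + 2))
    (d * ((d : ℂ) ^ 2 - 1) / (d + 2)) ((6 + ((d : ℂ) - 1) * d ^ 2) / (d + 2))
    (((d : ℂ) - 1) * (d ^ 2 + 3 * d + 4) / (d + 2))
    (d * ((d : ℂ) ^ 2 - 1) / (d + 2)) ((6 + ((d : ℂ) - 1) * d ^ 2) / (d + 2))
  rw [BilocalTwirl.bilocalTrace] at h
  rw [h]
  have hd : (d : ℂ) + 2 ≠ 0 := by exact_mod_cast (Nat.succ_ne_zero (d + 1))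
  -- The constant term matches because (d-1)(d²+3d+4) = d(d+1)² - 4.
  field_simp
  ring
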